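/- Let $X$ be a Tychonoff space. A topological space $S$ is called countably pracompact if it has a dense subset $D$ such that every infinite subset of $D$ has a limit point in $S$; a space is $\sigma$-countably pracompact if it is the union of countably many countably pracompact subspaces. Let $\lambda_c$ be the family of all subspaces of $X$ that have a dense $\sigma$-countably pracompact subspace. For a non-closed set $A\subseteq X$ and a point $x\in\overline{A}\setminus A$, consider the following game with steps $n\in\mathbb{N}$: at the $n$-th step player ONE chooses a neighborhood $V_n$ of $x$, and then player TWO chooses a set $S_n\subseteq A$ that is contained in $\overline{T_n}$ for some $T_n\in\lambda_c$. Player TWO wins if $\overline{\bigcup_{n} S_n}\cap\bigcap_{n} V_n\neq\emptyset$; otherwise player ONE wins. Suppose that $X$ is an $AV_{\lambda_c}$-space, that is, for every non-closed set $A\subseteq X$ there is a point $x\in\overline{A}\setminus A$ for which player TWO has a winning strategy in this game. Let $C_p(X)$ be the space of continuous functions $X\to\mathbb{R}$ with the topology of pointwise convergence. Then every pseudocompact subspace $P$ of $C_p(X)$ (that is, one on which every continuous real-valued function $P\to\mathbb{R}$ is bounded) is relatively compact, that is, the closure of $P$ in $C_p(X)$ is compact. -/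

import Mathlib

open Set Filter Topology TopologicalSpace

namespace AsanovVelichko

/-- `C_p(X)`: the continuous real-valued functions on `X` with the topology of pointwise
convergence, i.e. the topology induced from the product `X → ℝ`. -/
abbrev Cp (X : Type*) [TopologicalSpace X] : Type _ := {f : X → ℝ // Continuous f}

/-- The subspace `P` of `Y` is pseudocompact: every continuous real-valued function defined on the
subspace `P` is bounded. -/
def IsPseudocompact {Y : Type*} [TopologicalSpace Y] (P : Set Y) : Prop :=
  ∀ f : P → ℝ, Continuous f → ∃ M : ℝ, ∀ p : P, |f p| ≤ M

/-- The subset `P` of `Y` is relatively compact: its closure in `Y` is compact. -/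
def IsRelativelyCompact {Y : Type*} [TopologicalSpace Y] (P : Set Y) : Prop :=
  IsCompact (closure P)

/-- The subspace `S` of `X` is a countably pracompact space: it contains a set `D` that is dense
in `S` and such that every infinite subset of `D` has a limit point in `S`. -/
def IsCountablyPracompact {X : Type*} [TopologicalSpace X] (S : Set X) : Prop :=
  ∃ D : Set X, D ⊆ S ∧ S ⊆ closure D ∧
    ∀ B : Set X, B ⊆ D → B.Infinite → ∃ x ∈ S, AccPt x (𝓟 B)

/-- The subspace `S` of `X` is the union of countably many countably pracompact subspaces. -/
def IsSigmaCountablyPracompact {X : Type*} [TopologicalSpace X] (S : Set X) : Prop :=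
  ∃ K : ℕ → Set X, (∀ n, IsCountablyPracompact (K n)) ∧ S = ⋃ n, K n

/-- The family `λ_c` of all subspaces `Z` of `X` that have a dense `σ`-countably pracompact
subspace `W`. -/
def lambdaC (X : Type*) [TopologicalSpace X] : Set (Set X) :=
  {Z | ∃ W : Set X, W ⊆ Z ∧ Z ⊆ closure W ∧ IsSigmaCountablyPracompact W}

/-- A strategy of player TWO when player ONE chooses neighborhoods of `x`: it gives the set
`S_n`, knowing the neighborhoods `V_0, …, V_n` chosen so far by player ONE. -/
abbrev Strategy {X : Type*} [TopologicalSpace X] (x : X) : Type _ :=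
  (n : ℕ) → (Fin (n + 1) → OpenNhdsOf x) → Set X

/-- The set `S_n` that player TWO chooses at step `n` by following the strategy `σ` against the
moves `V_0, V_1, …` of player ONE. -/
def Strategy.move {X : Type*} [TopologicalSpace X] {x : X} (σ : Strategy x)
    (V : ℕ → OpenNhdsOf x) (n : ℕ) : Set X :=
  σ n (fun i => V i)

/-- The strategy `σ` of player TWO is winning in the Asanov–Velichko game generated by the family
`l`, played on the set `A` at the point `x`: against all moves of player ONE, each set `S_n`
chosen by `σ` is a subset of `A` contained in the closure of some member of `l`, and the closure
of `⋃ S_n` meets `⋂ V_n`. -/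
def Strategy.IsWinning {X : Type*} [TopologicalSpace X] {x : X} (σ : Strategy x)
    (l : Set (Set X)) (A : Set X) : Prop :=
  ∀ V : ℕ → OpenNhdsOf x,
    (∀ n, σ.move V n ⊆ A ∧ ∃ T ∈ l, σ.move V n ⊆ closure T) ∧
    (closure (⋃ n, σ.move V n) ∩ ⋂ n, (V n : Set X)).Nonempty

/-- `X` is Asanov–Velichko generated by the family `l` (an `AV_l`-space). -/
def IsAVSpace (X : Type*) [TopologicalSpace X] (l : Set (Set X)) : Prop :=
  ∀ A : Set X, ¬ IsClosed A →
    ∃ x ∈ closure A \ A, ∃ σ : Strategy x, σ.IsWinning l A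

end AsanovVelichko

namespace AsanovVelichko

/-- Recursive choice of a sequence whose `n`-th term is related to the tuple of its predecessors. -/
theorem exists_seq_of_history {β : Type*} (R : (n : ℕ) → (Fin n → β) → β → Prop)
    (h : ∀ n l, ∃ b, R n l b) : ∃ s : ℕ → β, ∀ n, R n (fun i => s i) (s n) := by
  choose F hF using h
  let s : ℕ → β := WellFounded.fix (C := fun _ => β) Nat.lt_wfRel.wf
    fun n rec => F n fun i => rec i i.2
  have hs : ∀ n, s n = F n fun i => s i := fun n => WellFounded.fix_eq _ _ _
  refine ⟨s, fun n => ?_⟩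
  rw [hs n]
  exact hF n _

/-- Dependent choice along a chain of valid states. -/
theorem exists_chain {α : Type*} (p : α → Prop) (R : ℕ → α → α → Prop) (a : α) (ha : p a)
    (h : ∀ n a, p a → ∃ b, p b ∧ R n a b) :
    ∃ s : ℕ → α, (∀ n, p (s n)) ∧ ∀ n, R n (s n) (s (n + 1)) := by
  choose F hF hR using h
  let s : ℕ → {a // p a} := fun n =>
    Nat.rec ⟨a, ha⟩ (fun n b => ⟨F n b.1 b.2, hF n b.1 b.2⟩) n
  exact ⟨fun n => (s n).1, fun n => (s n).2, fun n => hR n (s n).1 (s n).2⟩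

/-- Every sequence of nonempty open sets has a point lying in every closed set that contains
almost all members of the sequence; in other words, no such sequence is locally finite. -/
def FeeblyCompact (Q : Type*) [TopologicalSpace Q] : Prop :=
  ∀ U : ℕ → Set Q, (∀ n, IsOpen (U n)) → (∀ n, (U n).Nonempty) →
    ∃ p, ∀ A : Set Q, IsClosed A → (∀ᶠ n in atTop, U n ⊆ A) → p ∈ A

theorem feeblyCompact_of_forall_bounded {Q : Type*} [TopologicalSpace Q]
    [CompletelyRegularSpace Q]
    (hQ : ∀ f : Q → ℝ, Continuous f → ∃ M : ℝ, ∀ p, |f p| ≤ M) : FeeblyCompact Q := by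
  intro U hU hne
  by_contra! hcon
  have hlf : LocallyFinite U := by
    intro p
    obtain ⟨A, hA, hUA, hp⟩ := hcon p
    refine ⟨Aᶜ, hA.isOpen_compl.mem_nhds hp, ?_⟩
    obtain ⟨N, hN⟩ := eventually_atTop.1 hUA
    refine (finite_lt_nat N).subset fun n hn => ?_
    by_contra hnN
    obtain ⟨q, hq, hqA⟩ := hn
    exact hqA (hN n (not_lt.1 hnN) hq)
  choose q hq using hne
  have hbump : ∀ n, ∃ f : Q → ℝ, Continuous f ∧ (∀ x, 0 ≤ f x) ∧ f (q n) = n ∧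
      Function.support f ⊆ U n := by
    intro n
    obtain ⟨f, hf, hf0, hf1⟩ := CompletelyRegularSpace.completely_regular (q n) (U n)ᶜ
      (hU n).isClosed_compl (by simpa using hq n)
    refine ⟨fun x => n * (1 - f x), by fun_prop, fun x => ?_, by simp [hf0], fun x hx => ?_⟩
    · exact mul_nonneg n.cast_nonneg (sub_nonneg.2 (f x).2.2)
    · by_contra hxU
      exact hx (by simp [hf1 hxU])
  choose f hfc hf0 hfq hfs using hbump
  have hlf' : LocallyFinite fun n => Function.support (f n) := hlf.subset hfs
  obtain ⟨M, hM⟩ := hQ (fun x => ∑ᶠ n, f n x) (continuous_finsum hfc hlf')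
  obtain ⟨n, hn⟩ := exists_nat_gt M
  have h1 : f n (q n) ≤ ∑ᶠ k, f k (q n) :=
    single_le_finsum n (hlf'.point_finite (q n)) fun k => hf0 k _
  have h2 := (le_abs_self _).trans (hM (q n))
  rw [hfq] at h1
  linarith

/-- Every sequence in `D` has a cluster point in the ambient space. -/
def IsRelativelyCountablyCompact {X : Type*} [TopologicalSpace X] (D : Set X) : Prop :=
  ∀ u : ℕ → X, (∀ n, u n ∈ D) → ∃ z, MapClusterPt z atTop u

theorem isRelativelyCountablyCompact_of_forall_accPt {X : Type*} [TopologicalSpace X] [T1Space X]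
    {D : Set X} (hD : ∀ B ⊆ D, B.Infinite → ∃ x, AccPt x (𝓟 B)) :
    IsRelativelyCountablyCompact D := by
  intro u hu
  by_cases hfin : (range u).Finite
  · obtain ⟨z, -, hz⟩ := hfin.isCompact (f := map u atTop)
      (le_principal_iff.2 (mem_map.2 (by simp)))
    exact ⟨z, hz⟩
  · obtain ⟨z, hz⟩ := hD (range u) (range_subset_iff.2 hu) hfin
    refine ⟨z, mapClusterPt_iff_frequently.2 fun s hs => ?_⟩
    by_contra hns
    obtain ⟨N, hN⟩ := eventually_atTop.1 (not_frequently.1 hns)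
    have hF : ((u '' Iio N) \ {z}).Finite := ((finite_Iio N).image u).sdiff
    have hmem : s ∩ ((u '' Iio N) \ {z})ᶜ ∈ 𝓝 z :=
      inter_mem hs (hF.isClosed.isOpen_compl.mem_nhds (by simp))
    obtain ⟨y, ⟨hyz, n, rfl⟩, hys, hyF⟩ :=
      ((accPt_iff_frequently.1 hz).and_eventually hmem).exists
    refine hyF ⟨⟨n, ?_, rfl⟩, hyz⟩
    by_contra hn
    exact hN n (not_lt.1 hn) hys

theorem IsRelativelyCountablyCompact.singleton {X : Type*} [TopologicalSpace X] (x : X) :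
    IsRelativelyCountablyCompact ({x} : Set X) := fun u hu =>
  ⟨x, by
    have : u = fun _ => x := funext hu
    rw [this]
    exact tendsto_const_nhds.mapClusterPt⟩

/-- A sequence in a relatively countably compact set has a point `z` of the closure such that
countably many given continuous functions converge to their values at `z` along a subsequence. -/
theorem IsRelativelyCountablyCompact.exists_subseq {X : Type*} [TopologicalSpace X] {D : Set X}
    (hD : IsRelativelyCountablyCompact D) (u : ℕ → X) (hu : ∀ n, u n ∈ D) (F : ℕ → X → ℝ)
    (hF : ∀ i, Continuous (F i)) :
    ∃ z ∈ closure (range u), ∃ φ : ℕ → ℕ, StrictMono φ ∧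
      ∀ i, Tendsto (fun n => F i (u (φ n))) atTop (𝓝 (F i z)) := by
  obtain ⟨z, hz⟩ := hD u hu
  have hc : MapClusterPt (fun i => F i z) atTop ((fun x i => F i x) ∘ u) :=
    hz.continuousAt_comp (f := fun x i => F i x) (continuous_pi hF).continuousAt
  obtain ⟨φ, hφ, ht⟩ := hc.tendsto_subseq
  refine ⟨z, ?_, φ, hφ, fun i => (tendsto_pi_nhds.1 ht) i⟩
  refine mem_closure_iff_nhds.2 fun s hs => ?_
  obtain ⟨n, hn⟩ := (mapClusterPt_iff_frequently.1 hz s hs).exists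
  exact ⟨u n, hn, n, rfl⟩

/-- Any set has a finite subset approximating each of its points with respect to the bounded
pseudometrics given by finitely many functions composed with `arctan`. -/
theorem exists_finite_arctan_net {X ι : Type*} [Finite ι] (h : ι → X → ℝ) (D : Set X) {δ : ℝ}
    (hδ : 0 < δ) : ∃ F ⊆ D, F.Finite ∧ ∀ x ∈ D, ∃ y ∈ F, ∀ i,
      |Real.arctan (h i x) - Real.arctan (h i y)| < δ := by
  have := Fintype.ofFinite ι
  let H : X → ι → ℝ := fun x i => Real.arctan (h i x)
  have hb : TotallyBounded (H '' D) := by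
    refine (isCompact_univ_pi fun _ : ι =>
      isCompact_Icc (a := -(Real.pi / 2)) (b := Real.pi / 2)).totallyBounded.subset ?_
    rintro _ ⟨x, -, rfl⟩ i -
    exact ⟨(Real.neg_pi_div_two_lt_arctan _).le, (Real.arctan_lt_pi_div_two _).le⟩
  obtain ⟨t, htD, htf, ht⟩ := Metric.finite_approx_of_totallyBounded hb δ hδ
  choose g hg using htD
  have := htf.to_subtype
  refine ⟨range fun v : t => g v.2, ?_, finite_range _, fun x hx => ?_⟩
  · rintro _ ⟨v, rfl⟩
    exact (hg v.2).1
  · obtain ⟨v, hv, hxv⟩ := mem_iUnion₂.1 (ht (mem_image_of_mem H hx))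
    refine ⟨g hv, ⟨⟨v, hv⟩, rfl⟩, fun i => ?_⟩
    rw [← (hg hv).2] at hxv
    exact (Real.dist_eq _ _).symm.trans_lt ((dist_pi_lt_iff hδ).1 hxv i)

theorem isOpen_forall_mem_abs_sub_lt {Q X : Type*} [TopologicalSpace Q] {ev : Q → X → ℝ}
    (hev : ∀ x, Continuous fun q => ev q x) {F : Set X} (hF : F.Finite) (c : X → ℝ) (δ : ℝ) :
    IsOpen {q | ∀ y ∈ F, |ev q y - c y| < δ} := by
  simp only [ofPred_forall]
  exact hF.isOpen_biInter fun i _ =>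
    isOpen_lt (((hev _).sub continuous_const).abs) continuous_const

/-- Over a feebly compact space of continuous functions, convergence on a countable set implies
convergence on its closure. -/
theorem FeeblyCompact.tendsto_of_mem_closure_range {Q X : Type*} [TopologicalSpace Q]
    [TopologicalSpace X] (hQ : FeeblyCompact Q) {ev : Q → X → ℝ}
    (hev : ∀ x, Continuous fun q => ev q x) (hc : ∀ q, Continuous (ev q)) {f : ℕ → Q} {p : Q}
    {b : ℕ → X} (hb : ∀ i, Tendsto (fun n => ev (f n) (b i)) atTop (𝓝 (ev p (b i)))) {y : X}
    (hy : y ∈ closure (range b)) : Tendsto (fun n => ev (f n) y) atTop (𝓝 (ev p y)) := by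
  by_contra hcon
  rw [Metric.tendsto_atTop] at hcon
  push Not at hcon
  obtain ⟨ε, hε, hfar⟩ := hcon
  let O : ℕ → Set Q := fun k =>
    {q | ∀ z ∈ b '' Iic k, |ev q z - ev p z| < 1 / ((k : ℝ) + 1)} ∩
      {q | ε / 2 < |ev q y - ev p y|}
  have hO : ∀ k, IsOpen (O k) := fun k =>
    (isOpen_forall_mem_abs_sub_lt hev ((finite_Iic k).image b) _ _).inter
      (isOpen_lt continuous_const (((hev y).sub continuous_const).abs))
  have hne : ∀ k, (O k).Nonempty := by
    intro k
    have h1 : ∀ᶠ n in atTop, ∀ i ∈ Iic k, |ev (f n) (b i) - ev p (b i)| < 1 / ((k : ℝ) + 1) := by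
      refine (finite_Iic k).eventually_all.2 fun i _ => ?_
      exact Metric.tendsto_nhds.1 (hb i) _ (by positivity)
    obtain ⟨N, hN⟩ := eventually_atTop.1 h1
    obtain ⟨n, hn, hnε⟩ := hfar N
    rw [Real.dist_eq] at hnε
    exact ⟨f n, forall_mem_image.2 (hN n hn), by simp only [mem_ofPred_eq]; linarith⟩
  obtain ⟨q, hq⟩ := hQ O hO hne
  have hqb : EqOn (ev q) (ev p) (range b) := by
    rintro _ ⟨i, rfl⟩
    have : ∀ m : ℕ, |ev q (b i) - ev p (b i)| ≤ 1 / ((m : ℝ) + 1) := by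
      intro m
      refine hq {q | |ev q (b i) - ev p (b i)| ≤ 1 / ((m : ℝ) + 1)}
        (isClosed_le (((hev _).sub continuous_const).abs) continuous_const) ?_
      filter_upwards [eventually_ge_atTop i, eventually_ge_atTop m] with n hni hnm r hr
      exact (hr.1 _ (mem_image_of_mem b hni)).le.trans (Nat.one_div_le_one_div hnm)
    have h0 := ge_of_tendsto' tendsto_one_div_add_atTop_nhds_zero_nat this
    exact sub_eq_zero.1 (abs_eq_zero.1 (le_antisymm h0 (abs_nonneg _)))
  have h1 : ev q y = ev p y := hqb.closure (hc q) (hc p) hy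
  have h2 := hq {q | ε / 2 ≤ |ev q y - ev p y|}
    (isClosed_le continuous_const (((hev _).sub continuous_const).abs))
    (Eventually.of_forall fun n r hr => mem_ofPred.2 (le_of_lt hr.2))
  simp only [mem_ofPred_eq, h1, sub_self, abs_zero] at h2
  linarith

/-- If `D` does not have small oscillation on any nonempty open subset of `U`, then the values at
points of `D` of members of an open `V ⊆ U` are not controlled by finitely many functions. -/
theorem exists_pair_of_large_oscillation {Q X : Type*} [TopologicalSpace Q]
    {ev : Q → X → ℝ} (hev : ∀ x, Continuous fun q => ev q x) {D : Set X} {ε : ℝ} (hε : 0 < ε)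
    {V : Set Q} (hV : IsOpen V) (hVne : V.Nonempty)
    (hosc : ∀ V' ⊆ V, IsOpen V' → V'.Nonempty →
      ∃ x ∈ D, ∃ q ∈ V', ∃ r ∈ V', ε < |ev q x - ev r x|)
    {G : Set Q} (hG : G.Finite) {δ : ℝ} (hδ : 0 < δ) :
    ∃ x ∈ D, ∃ x' ∈ D, (∀ g ∈ G, |Real.arctan (ev g x) - Real.arctan (ev g x')| < δ) ∧
      ∃ q ∈ V, ε / 4 < |ev q x - ev q x'| := by
  by_contra! hcon
  have := hG.to_subtype
  obtain ⟨F, hFD, hF, hnet⟩ := exists_finite_arctan_net (fun g : G => ev g) D hδ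
  obtain ⟨q₀, hq₀⟩ := hVne
  let V' : Set Q := V ∩ {q | ∀ y ∈ F, |ev q y - ev q₀ y| < ε / 4}
  have hV' : IsOpen V' := 
    hV.inter (isOpen_forall_mem_abs_sub_lt hev hF _ _)
  obtain ⟨x, hx, q, hq, r, hr, hqr⟩ := hosc V' inter_subset_left hV'
    ⟨q₀, hq₀, fun y _ => by simpa using by positivity⟩
  obtain ⟨y, hy, hxy⟩ := hnet x hx
  have key := hcon x hx y (hFD hy) fun g hg => hxy ⟨g, hg⟩
  have h1 := key q hq.1
  have h2 := key r hr.1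
  have h3 := hq.2 y hy
  have h4 := hr.2 y hy
  rw [abs_le] at h1 h2
  rw [abs_lt] at h3 h4
  rcases lt_abs.1 hqr with h | h <;> linarith

/-- Fragmentability: over a feebly compact space of continuous functions, every nonempty open set
contains a nonempty open set with small oscillation on a relatively countably compact set. -/
theorem FeeblyCompact.exists_small_oscillation {Q X : Type*} [TopologicalSpace Q]
    [TopologicalSpace X] (hQ : FeeblyCompact Q) {ev : Q → X → ℝ}
    (hev : ∀ x, Continuous fun q => ev q x) (hc : ∀ q, Continuous (ev q)) {D : Set X}
    (hD : IsRelativelyCountablyCompact D) {U : Set Q} (hU : IsOpen U) (hUne : U.Nonempty) {ε : ℝ}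
    (hε : 0 < ε) :
    ∃ V ⊆ U, IsOpen V ∧ V.Nonempty ∧ ∀ x ∈ D, ∀ q ∈ V, ∀ r ∈ V, |ev q x - ev r x| ≤ ε := by
  by_contra! hosc
  obtain ⟨s, hs, hR⟩ := exists_chain (α := Set Q × Set Q × Set X)
    (fun a => a.1 ⊆ U ∧ IsOpen a.1 ∧ a.1.Nonempty ∧ a.2.1.Finite ∧ a.2.2.Finite)
    (fun n a b => b.1 ⊆ a.1 ∧ ∃ f x x', x ∈ D ∧ x' ∈ D ∧ b.2.1 = insert f a.2.1 ∧
      b.2.2 = insert x (insert x' a.2.2) ∧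
      (∀ g ∈ b.2.1, |Real.arctan (ev g x) - Real.arctan (ev g x')| < 1 / ((n : ℝ) + 1)) ∧
      (∀ q ∈ b.1, ε / 4 < |ev q x - ev q x'|) ∧
      ∀ q ∈ b.1, ∀ z ∈ a.2.2, |ev q z - ev f z| < 1 / ((n : ℝ) + 1))
    (U, ∅, ∅) ⟨Subset.rfl, hU, hUne, finite_empty, finite_empty⟩ (by
      rintro n ⟨V, G, L⟩ ⟨hVU, hV, ⟨f, hf⟩, hG, hL⟩
      let V₁ : Set Q := V ∩ {q | ∀ z ∈ L, |ev q z - ev f z| < 1 / ((n : ℝ) + 1)}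
      have hV₁ : IsOpen V₁ := 
        hV.inter (isOpen_forall_mem_abs_sub_lt hev hL _ _)
      have hfV₁ : f ∈ V₁ := ⟨hf, fun z _ => by simpa using by positivity⟩
      obtain ⟨x, hx, x', hx', hxx', q, hq, hqx⟩ := exists_pair_of_large_oscillation hev hε hV₁
        ⟨f, hfV₁⟩ (fun V' h1 h2 h3 => hosc V' (h1.trans (inter_subset_left.trans hVU)) h2 h3)
        (hG.insert f) (δ := 1 / ((n : ℝ) + 1)) (by positivity)
      refine ⟨(V₁ ∩ {q | ε / 4 < |ev q x - ev q x'|}, insert f G, insert x (insert x' L)),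
        ⟨?_, ?_, ⟨q, hq, hqx⟩, hG.insert f, (hL.insert x').insert x⟩, ?_, f, x, x', hx, hx', rfl,
        rfl, hxx', fun q hq => hq.2, fun q hq => hq.1.2⟩
      · exact inter_subset_left.trans (inter_subset_left.trans hVU)
      · exact hV₁.inter (isOpen_lt continuous_const (((hev _).sub (hev _)).abs))
      · exact inter_subset_left.trans inter_subset_left)
  choose hanti f x x' hx hx' hG hL harc hfar hnear using hR
  have hV : Antitone fun n => (s n).1 := antitone_nat_of_succ_le hanti
  have hGm : Monotone fun n => (s n).2.1 :=
    monotone_nat_of_le_succ fun n => (subset_insert _ _).trans (hG n).ge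
  have hLm : Monotone fun n => (s n).2.2 :=
    monotone_nat_of_le_succ fun n =>
      ((subset_insert _ _).trans (subset_insert _ _)).trans (hL n).ge
  obtain ⟨p, hp⟩ := hQ (fun n => (s n).1) (fun n => (hs n).2.1) fun n => (hs n).2.2.1
  have hpfar : ∀ n, ε / 4 ≤ |ev p (x n) - ev p (x' n)| := fun n =>
    hp {q | ε / 4 ≤ |ev q (x n) - ev q (x' n)|}
      (isClosed_le continuous_const (((hev _).sub (hev _)).abs))
      ((eventually_ge_atTop (n + 1)).mono fun m hm q hq => (hfar n q (hV hm hq)).le)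
  have hconv : ∀ n, ∀ z ∈ (s n).2.2, Tendsto (fun m => ev (f m) z) atTop (𝓝 (ev p z)) := by
    intro n z hz
    rw [tendsto_iff_dist_tendsto_zero]
    refine squeeze_zero' (Eventually.of_forall fun _ => dist_nonneg) ?_
      tendsto_one_div_add_atTop_nhds_zero_nat
    filter_upwards [eventually_ge_atTop n] with m hm
    rw [dist_comm, Real.dist_eq]
    exact hp {q | |ev q z - ev (f m) z| ≤ 1 / ((m : ℝ) + 1)}
      (isClosed_le (((hev _).sub continuous_const).abs) continuous_const)
      ((eventually_ge_atTop (m + 1)).mono fun k hk q hq =>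
        (hnear m q (hV hk hq) z (hLm hm hz)).le)
  have hconvx : ∀ y ∈ closure (range x), Tendsto (fun m => ev (f m) y) atTop (𝓝 (ev p y)) :=
    fun y hy => hQ.tendsto_of_mem_closure_range hev hc (fun i => hconv (i + 1) _
      ((hL i).ge (mem_insert _ _))) hy
  have hconvx' : ∀ y ∈ closure (range x'), Tendsto (fun m => ev (f m) y) atTop (𝓝 (ev p y)) :=
    fun y hy => hQ.tendsto_of_mem_closure_range hev hc (fun i => hconv (i + 1) _
      ((hL i).ge (mem_insert_of_mem _ (mem_insert _ _)))) hy
  let F : ℕ → X → ℝ := fun i => Nat.casesOn i (ev p) fun i => ev (f i)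
  have hF : ∀ i, Continuous (F i) := by
    rintro (_ | i)
    · exact hc p
    · exact hc (f i)
  obtain ⟨y, hy, φ, hφ, hyt⟩ := hD.exists_subseq x hx F hF
  obtain ⟨y', hy', ψ, hψ, hyt'⟩ := hD.exists_subseq (x' ∘ φ) (fun n => hx' _) F hF
  replace hyt := fun i => (hyt i).comp hψ.tendsto_atTop
  have hmono : StrictMono (φ ∘ ψ) := hφ.comp hψ
  have heq : ∀ i, ev (f i) y = ev (f i) y' := by
    intro i
    have h1 := (Real.continuous_arctan.tendsto _).comp (hyt (i + 1))
    have h2 := (Real.continuous_arctan.tendsto _).comp (hyt' (i + 1))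
    have h3 : Tendsto (fun n => |Real.arctan (ev (f i) (x (φ (ψ n)))) -
        Real.arctan (ev (f i) (x' (φ (ψ n))))|) atTop (𝓝 0) := by
      refine squeeze_zero' (Eventually.of_forall fun _ => abs_nonneg _) ?_
        (tendsto_one_div_add_atTop_nhds_zero_nat.comp hmono.tendsto_atTop)
      filter_upwards [eventually_ge_atTop i] with n hn
      refine (harc _ _ ?_).le
      exact hGm (Nat.succ_le_succ (hn.trans (hmono.id_le n))) ((hG i).ge (mem_insert _ _))
    have h4 := tendsto_nhds_unique h3 (h1.sub h2).abs
    exact Real.arctan_injective (sub_eq_zero.1 (abs_eq_zero.1 h4.symm))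
  have hne : ε / 4 ≤ |ev p y - ev p y'| :=
    ge_of_tendsto' ((hyt 0).sub (hyt' 0)).abs fun n => hpfar _
  have hyy' : ev p y = ev p y' := by
    refine tendsto_nhds_unique (hconvx y hy) ?_
    simp only [heq]
    exact hconvx' y' (closure_mono (range_comp_subset_range _ _) hy')
  rw [hyy', sub_self, abs_zero] at hne
  linarith

/-- Simultaneous version of fragmentability for finitely many sets. -/
theorem FeeblyCompact.exists_small_oscillation_forall_le {Q X : Type*} [TopologicalSpace Q]
    [TopologicalSpace X] (hQ : FeeblyCompact Q) {ev : Q → X → ℝ}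
    (hev : ∀ x, Continuous fun q => ev q x) (hc : ∀ q, Continuous (ev q)) {D : ℕ → Set X}
    (hD : ∀ j, IsRelativelyCountablyCompact (D j)) {U : Set Q} (hU : IsOpen U)
    (hUne : U.Nonempty) {ε : ℝ} (hε : 0 < ε) (n : ℕ) :
    ∃ V ⊆ U, IsOpen V ∧ V.Nonempty ∧
      ∀ j ≤ n, ∀ x ∈ D j, ∀ q ∈ V, ∀ r ∈ V, |ev q x - ev r x| ≤ ε := by
  induction n with
  | zero =>
    obtain ⟨V, hVU, hV, hVne, h⟩ := hQ.exists_small_oscillation hev hc (hD 0) hU hUne hε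
    exact ⟨V, hVU, hV, hVne, fun j hj => (Nat.le_zero.1 hj) ▸ h⟩
  | succ n ih =>
    obtain ⟨W, hWU, hW, hWne, hn⟩ := ih
    obtain ⟨V, hVW, hV, hVne, h⟩ := hQ.exists_small_oscillation hev hc (hD (n + 1)) hW hWne hε
    refine ⟨V, hVW.trans hWU, hV, hVne, fun j hj x hx q hq r hr => ?_⟩
    rcases Nat.le_succ_iff.1 hj with hj | rfl
    · exact hn j hj x hx q (hVW hq) r (hVW hr)
    · exact h x hx q hq r hr

/-- A pointwise limit of members of a feebly compact space of continuous functions agrees with one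
of its members on a given countable union of relatively countably compact sets. -/
theorem FeeblyCompact.exists_eq_on_iUnion {Q X : Type*} [TopologicalSpace Q]
    [TopologicalSpace X] (hQ : FeeblyCompact Q) {ev : Q → X → ℝ}
    (hev : ∀ x, Continuous fun q => ev q x) (hc : ∀ q, Continuous (ev q)) {D : ℕ → Set X}
    (hD : ∀ j, IsRelativelyCountablyCompact (D j)) {g : X → ℝ} (hg : g ∈ closure (range ev)) :
    ∃ p, ∀ j, ∀ x ∈ D j, ev p x = g x := by
  obtain ⟨s, hs⟩ := exists_seq_of_history (β := Set Q × Q × {F : Set X // F.Finite})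
    (fun n l b => IsOpen b.1 ∧ b.2.1 ∈ b.1 ∧
      (∀ j ≤ n, ∀ x ∈ D j, ∀ q ∈ b.1, |ev q x - ev b.2.1 x| ≤ 1 / ((n : ℝ) + 1)) ∧
      (∀ j ≤ n, ∀ x ∈ D j, ∃ y ∈ b.2.2.1, y ∈ D j ∧
        |Real.arctan (g x) - Real.arctan (g y)| < 1 / ((n : ℝ) + 1) ∧
        ∀ i, |Real.arctan (ev (l i).2.1 x) - Real.arctan (ev (l i).2.1 y)| < 1 / ((n : ℝ) + 1)) ∧
      ∀ i, ∀ y ∈ (l i).2.2.1, ∀ q ∈ b.1, |ev q y - g y| < 1 / ((n : ℝ) + 1)) (by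
    intro n l
    have hδ : 0 < 1 / ((n : ℝ) + 1) := by positivity
    have hF : (⋃ i, (l i).2.2.1).Finite := finite_iUnion fun i => (l i).2.2.2
    obtain ⟨_, hr, ⟨r, rfl⟩⟩ := mem_closure_iff.1 hg
      {h | ∀ y ∈ ⋃ i, (l i).2.2.1, |h y - g y| < 1 / ((n : ℝ) + 1)}
      (isOpen_forall_mem_abs_sub_lt (ev := fun h : X → ℝ => h) continuous_apply hF g _)
      (fun y _ => by simpa using hδ)
    obtain ⟨U, hUr, hU, ⟨f, hf⟩, hosc⟩ := hQ.exists_small_oscillation_forall_le hev hc hD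
      (isOpen_forall_mem_abs_sub_lt hev hF g (1 / ((n : ℝ) + 1))) ⟨r, hr⟩ hδ n
    have hnet := fun j => exists_finite_arctan_net
      (fun i : Option (Fin n) => i.elim g fun i => ev (l i).2.1) (D j) hδ
    choose F hFD hFfin hF using hnet
    refine ⟨(U, f, ⟨⋃ j ∈ Iic n, F j, (finite_Iic n).biUnion fun j _ => hFfin j⟩), hU, hf,
      fun j hj x hx q hq => hosc j hj x hx q hq f hf, fun j hj x hx => ?_, fun i y hy q hq => ?_⟩
    · obtain ⟨y, hy, hxy⟩ := hF j x hx
      exact ⟨y, mem_biUnion (mem_Iic.2 hj) hy, hFD j hy, hxy none, fun i => hxy (some i)⟩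
    · exact hUr hq y (mem_iUnion.2 ⟨i, hy⟩))
  choose hU hf hosc hnet hclose using hs
  obtain ⟨p, hp⟩ := hQ (fun n => (s n).1) hU fun n => ⟨_, hf n⟩
  have hpF : ∀ n, ∀ y ∈ (s n).2.2.1, ev p y = g y := by
    intro n y hy
    have : ∀ m : ℕ, |ev p y - g y| ≤ 1 / ((m : ℝ) + 1) := by
      intro m
      refine hp {q | |ev q y - g y| ≤ 1 / ((m : ℝ) + 1)}
        (isClosed_le (((hev _).sub continuous_const).abs) continuous_const) ?_
      filter_upwards [eventually_ge_atTop m, eventually_gt_atTop n] with k hkm hkn q hq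
      exact (hclose k ⟨n, hkn⟩ y hy q hq).le.trans (Nat.one_div_le_one_div hkm)
    have h0 := ge_of_tendsto' tendsto_one_div_add_atTop_nhds_zero_nat this
    exact sub_eq_zero.1 (abs_eq_zero.1 (le_antisymm h0 (abs_nonneg _)))
  refine ⟨p, fun j x hx => ?_⟩
  choose y hyF hyD hyg hyf using fun k => hnet (k + j) j (Nat.le_add_left _ _) x hx
  let F : ℕ → X → ℝ := fun i => Nat.casesOn i (ev p) fun i => ev (s i).2.1
  have hF : ∀ i, Continuous (F i) := by
    rintro (_ | i)
    · exact hc p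
    · exact hc _
  obtain ⟨z, hz, φ, hφ, hzt⟩ := (hD j).exists_subseq y hyD F hF
  have hzD : z ∈ closure (D j) := closure_mono (range_subset_iff.2 hyD) hz
  have hφj : StrictMono fun k => φ k + j := fun a b hab => Nat.add_lt_add_right (hφ hab) j
  have harc : ∀ {u : X → ℝ} {v : ℝ}, Tendsto (fun n => u (y (φ n))) atTop (𝓝 v) →
      (∀ᶠ k in atTop, |Real.arctan (u x) - Real.arctan (u (y (φ k)))| <
        1 / (((φ k + j : ℕ) : ℝ) + 1)) → u x = v := by
    intro u v hv hu
    have h1 := ((Real.continuous_arctan.tendsto _).comp hv).const_sub (Real.arctan (u x))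
    have h2 := squeeze_zero' (Eventually.of_forall fun _ => abs_nonneg _)
      (hu.mono fun _ h => le_of_lt h)
      (tendsto_one_div_add_atTop_nhds_zero_nat.comp hφj.tendsto_atTop)
    exact Real.arctan_injective
      (sub_eq_zero.1 (abs_eq_zero.1 (tendsto_nhds_unique h1.abs h2)))
  have hfz : ∀ i, ev (s i).2.1 x = ev (s i).2.1 z := fun i =>
    harc (hzt (i + 1)) ((eventually_gt_atTop i).mono fun k hk =>
      hyf (φ k) ⟨i, hk.trans_le ((hφ.id_le k).trans (Nat.le_add_right _ _))⟩)
  have hgz : g x = ev p z :=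
    harc ((hzt 0).congr fun k => hpF _ _ (hyF _)) (Eventually.of_forall fun k => hyg _)
  have hpz : ev p x = ev p z := by
    have : ∀ m : ℕ, |ev p x - ev p z| ≤ 2 * (1 / ((m : ℝ) + 1)) := by
      intro m
      refine hp {q | |ev q x - ev q z| ≤ 2 * (1 / ((m : ℝ) + 1))}
        (isClosed_le (((hev _).sub (hev _)).abs) continuous_const) ?_
      filter_upwards [eventually_ge_atTop m, eventually_ge_atTop j] with k hkm hkj q hq
      have h1 := hosc k j hkj x hx q hq
      have h2 : |ev q z - ev (s k).2.1 z| ≤ 1 / ((k : ℝ) + 1) :=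
        closure_minimal (s := D j) (t := {x | |ev q x - ev (s k).2.1 x| ≤ 1 / ((k : ℝ) + 1)})
          (fun x hx => hosc k j hkj x hx q hq)
          (isClosed_le (((hc _).sub (hc _)).abs) continuous_const) hzD
      have h3 := Nat.one_div_le_one_div (α := ℝ) hkm
      rw [hfz k] at h1
      rw [mem_ofPred_eq]
      rw [abs_le] at h1 h2 ⊢
      constructor <;> linarith
    have h0 := ge_of_tendsto' (tendsto_one_div_add_atTop_nhds_zero_nat.const_mul 2) this
    rw [mul_zero] at h0
    exact sub_eq_zero.1 (abs_eq_zero.1 (le_antisymm h0 (abs_nonneg _)))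
  rw [hpz, hgz]

theorem FeeblyCompact.exists_eq_on_closure_iUnion {Q X : Type*} [TopologicalSpace Q]
    [TopologicalSpace X] (hQ : FeeblyCompact Q) {ev : Q → X → ℝ}
    (hev : ∀ x, Continuous fun q => ev q x) (hc : ∀ q, Continuous (ev q)) {D : ℕ → Set X}
    (hD : ∀ j, IsRelativelyCountablyCompact (D j)) {g : X → ℝ} (hg : g ∈ closure (range ev)) :
    ∃ p, ∀ x ∈ closure (⋃ j, D j), ev p x = g x := by
  obtain ⟨p, hp⟩ := hQ.exists_eq_on_iUnion hev hc hD hg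
  refine ⟨p, fun x hx => ?_⟩
  obtain ⟨r, hr⟩ := hQ.exists_eq_on_iUnion hev hc
    (D := fun j => Nat.casesOn j {x} D) (by
      rintro (_ | j)
      · exact IsRelativelyCountablyCompact.singleton x
      · exact hD j) hg
  rw [← hr 0 x rfl]
  refine EqOn.closure ?_ (hc p) (hc r) hx
  intro y hy
  obtain ⟨j, hj⟩ := mem_iUnion.1 hy
  rw [hp j y hj, hr (j + 1) y hj]

theorem exists_relativelyCountablyCompact_of_mem_lambdaC {X : Type*} [TopologicalSpace X]
    [T1Space X] {T : Set X} (hT : T ∈ lambdaC X) :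
    ∃ D : ℕ → Set X, (∀ n, IsRelativelyCountablyCompact (D n)) ∧ closure T ⊆ closure (⋃ n, D n) := by
  obtain ⟨W, -, hTW, K, hK, rfl⟩ := hT
  choose D hDK hKD hD using hK
  refine ⟨D, fun n => isRelativelyCountablyCompact_of_forall_accPt fun B hB hBi =>
    (hD n B hB hBi).imp fun x hx => hx.2, ?_⟩
  refine closure_minimal (hTW.trans (closure_minimal (iUnion_subset fun n => ?_) isClosed_closure))
    isClosed_closure
  exact (hKD n).trans (closure_mono (subset_iUnion D n))

/-- A pointwise limit of members of a feebly compact space of continuous functions agrees with one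
of its members at a given point and on countably many given sets contained in closures of members of
`lambdaC X`. -/
theorem FeeblyCompact.exists_eq_on_of_lambdaC {Q X : Type*} [TopologicalSpace Q]
    [TopologicalSpace X] [T1Space X] (hQ : FeeblyCompact Q) {ev : Q → X → ℝ}
    (hev : ∀ x, Continuous fun q => ev q x) (hc : ∀ q, Continuous (ev q)) {S : ℕ → Set X}
    (hS : ∀ n, ∃ T ∈ lambdaC X, S n ⊆ closure T) {g : X → ℝ} (hg : g ∈ closure (range ev))
    (x : X) : ∃ p, ev p x = g x ∧ ∀ n, ∀ y ∈ S n, ev p y = g y := by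
  have : ∀ n, ∃ D : ℕ → Set X, (∀ n, IsRelativelyCountablyCompact (D n)) ∧
      S n ⊆ closure (⋃ n, D n) := fun n => by
    obtain ⟨T, hT, hST⟩ := hS n
    obtain ⟨D, hD, hTD⟩ := exists_relativelyCountablyCompact_of_mem_lambdaC hT
    exact ⟨D, hD, hST.trans hTD⟩
  choose D hD hSD using this
  let E : ℕ → Set X := fun j => Nat.casesOn j {x} fun j => D j.unpair.1 j.unpair.2
  obtain ⟨p, hp⟩ := hQ.exists_eq_on_closure_iUnion hev hc (D := E) (by
    rintro (_ | j)
    · exact IsRelativelyCountablyCompact.singleton x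
    · exact hD _ _) hg
  refine ⟨p, hp x (subset_closure (mem_iUnion.2 ⟨0, rfl⟩)), fun n y hy => hp y ?_⟩
  refine closure_mono (iUnion_subset fun j => ?_) (hSD n hy)
  refine subset_iUnion_of_subset (Nat.pair n j + 1) ?_
  simp [E]

/-- On an Asanov–Velichko space generated by `lambdaC X`, pointwise limits of members of a feebly
compact space of continuous functions are continuous. -/
theorem FeeblyCompact.continuous_of_mem_closure_range {Q X : Type*} [TopologicalSpace Q]
    [TopologicalSpace X] [T1Space X] (hX : IsAVSpace X (lambdaC X)) (hQ : FeeblyCompact Q)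
    {ev : Q → X → ℝ} (hev : ∀ x, Continuous fun q => ev q x) (hc : ∀ q, Continuous (ev q))
    (hcomp : IsCompact (closure (range ev))) {g : X → ℝ} (hg : g ∈ closure (range ev)) :
    Continuous g := by
  by_contra hgc
  rw [continuous_iff_isClosed] at hgc
  push Not at hgc
  obtain ⟨C, hC, hA⟩ := hgc
  obtain ⟨x, ⟨-, hxA⟩, σ, hσ⟩ := hX _ hA
  obtain ⟨s, hs⟩ := exists_seq_of_history (β := OpenNhdsOf x × Q)
    (fun n l b => ev b.2 x = g x ∧
      (∀ i : Fin n, ∀ y ∈ σ i (fun k => (l ⟨k, by omega⟩).1), ev b.2 y = g y) ∧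
      ∀ i, ∀ y ∈ b.1, |ev (l i).2 y - ev (l i).2 x| < 1 / ((n : ℝ) + 1)) (by
    intro n l
    have hδ : 0 < 1 / ((n : ℝ) + 1) := by positivity
    let V : ℕ → OpenNhdsOf x := fun i => if h : i < n then (l ⟨i, h⟩).1 else ⊤
    obtain ⟨p, hpx, hp⟩ := hQ.exists_eq_on_of_lambdaC hev hc (fun i => ((hσ V).1 i).2) hg x
    have hopen : IsOpen (⋂ i, {y | |ev (l i).2 y - ev (l i).2 x| < 1 / ((n : ℝ) + 1)}) :=
      isOpen_iInter_of_finite fun i =>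
        isOpen_lt (((hc _).sub continuous_const).abs) continuous_const
    refine ⟨(⟨⟨_, hopen⟩, mem_iInter.2 fun i => by simpa using hδ⟩, p), hpx,
      fun i y hy => hp i y ?_, fun i y hy => mem_iInter.1 hy i⟩
    have hV : (fun k : Fin (i + 1) => V k) = fun k : Fin (i + 1) => (l ⟨k, by omega⟩).1 := by
      funext k
      have hk : (k : ℕ) < n := by omega
      simp [V, hk]
    rw [Strategy.move, hV]
    exact hy)
  choose hsx hsS hold using hs
  let V : ℕ → OpenNhdsOf x := fun n => (s n).1
  obtain ⟨hleg, z, hzS, hzV⟩ := hσ V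
  have hsS' : ∀ n i, i < n → ∀ y ∈ σ.move V i, ev (s n).2 y = g y := fun n i hi =>
    hsS n ⟨i, hi⟩
  have hsz : ∀ n, ev (s n).2 z = g x := by
    intro n
    rw [← hsx n]
    have : ∀ᶠ m : ℕ in atTop, |ev (s n).2 z - ev (s n).2 x| ≤ 1 / ((m : ℝ) + 1) :=
      (eventually_gt_atTop n).mono fun m hm => (hold m ⟨n, hm⟩ z (mem_iInter.1 hzV m)).le
    have h0 := ge_of_tendsto tendsto_one_div_add_atTop_nhds_zero_nat this
    exact sub_eq_zero.1 (abs_eq_zero.1 (le_antisymm h0 (abs_nonneg _)))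
  obtain ⟨h, hh, hcl⟩ := hcomp (f := map (fun n => ev (s n).2) atTop)
    (le_principal_iff.2 (mem_map.2 (Eventually.of_forall fun n =>
      subset_closure (mem_range_self _))))
  have hlim : ∀ y c, (∀ᶠ n in atTop, ev (s n).2 y = c) → h y = c := by
    intro y c hyc
    have h1 : MapClusterPt (h y) atTop fun n => ev (s n).2 y :=
      MapClusterPt.continuousAt_comp (f := fun u : X → ℝ => u y)
        (continuous_apply y).continuousAt hcl
    by_contra hne
    obtain ⟨n, hn, hn'⟩ := ((h1.frequently (isOpen_ne.mem_nhds hne)).and_eventually hyc).exists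
    exact hn hn'
  obtain ⟨p, hpz, hp⟩ := hQ.exists_eq_on_of_lambdaC hev hc (fun i => (hleg i).2) hh z
  have hpC : ev p z ∈ C := by
    refine closure_minimal (t := ev p ⁻¹' C) (iUnion_subset fun i y hy => ?_)
      (hC.preimage (hc p)) hzS
    rw [mem_preimage, hp i y hy,
      hlim y (g y) ((eventually_gt_atTop i).mono fun n hn => hsS' n i hn y hy)]
    exact (hleg i).1 hy
  rw [hpz, hlim z (g x) (Eventually.of_forall hsz)] at hpC
  exact hxA hpC

theorem isCompact_closure_range_of_forall_bounded {Q X : Type*} {ev : Q → X → ℝ}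
    (hb : ∀ x, ∃ M, ∀ q, |ev q x| ≤ M) : IsCompact (closure (range ev)) := by
  choose M hM using hb
  refine (isCompact_univ_pi fun x => isCompact_Icc (a := -M x) (b := M x)).closure_of_subset ?_
  rintro _ ⟨q, rfl⟩ x -
  exact abs_le.1 (hM x q)

end AsanovVelichko

open AsanovVelichko in
theorem theorem1p10 {X : Type*} [TopologicalSpace X] [T35Space X]
    (hX : AsanovVelichko.IsAVSpace X (AsanovVelichko.lambdaC X))
    (P : Set (AsanovVelichko.Cp X)) (hP : AsanovVelichko.IsPseudocompact P) :
    AsanovVelichko.IsRelativelyCompact P := by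
  have hev : ∀ x, Continuous fun p : P => p.1.1 x := fun x =>
    (continuous_apply x).comp (continuous_subtype_val.comp continuous_subtype_val)
  have hQ : FeeblyCompact P := feeblyCompact_of_forall_bounded hP
  have hcomp : IsCompact (closure (range fun p : P => p.1.1)) :=
    isCompact_closure_range_of_forall_bounded fun x => hP _ (hev x)
  have hrange : range (fun p : P => p.1.1) = Subtype.val '' P := by
    rw [image_eq_range]
  have hind : IsInducing (Subtype.val : Cp X → X → ℝ) := IsInducing.subtypeVal
  rw [IsRelativelyCompact, hind.isCompact_iff, hind.closure_eq_preimage_closure_image,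
    image_preimage_eq_of_subset, ← hrange]
  · exact hcomp
  · rw [← hrange]
    exact fun g hg => ⟨⟨g, hQ.continuous_of_mem_closure_range hX hev (fun p => p.1.2) hcomp hg⟩, rfl⟩
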